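/- **Theorem (Convergence of PNPD).** Let $A\in\mathbb{R}^{s\times d}$, $b^\delta\in\mathbb{R}^s$, $W\in\mathbb{R}^{d'\times d}$, and let $f(u)=\tfrac12\|Au-b^\delta\|^2$, where $\|\cdot\|$ is the Euclidean norm on vectors and the induced operator (spectral) norm on matrices. Let $h:\mathbb{R}^{d'}\to\mathbb{R}\cup\{\infty\}$ be proper, convex and lower semicontinuous, and assume that there is $x\in\mathbb{R}^d$ with $Wx\in\operatorname{relint}(\operatorname{dom} h)$. Let $S\in\mathbb{R}^{s\times s}$ and $P\in\mathbb{R}^{d\times d}$ be symmetric positive definite with $P^{-1}A^T=A^TS^{-1}$. Assume that the problem $$\min_{u\in\mathbb{R}^d}\ \tfrac12\|Au-b^\delta\|_{S^{-1}}^2+h(Wu),\qquad \|x\|_{S^{-1}}=\sqrt{x^TS^{-1}x},\tag{1}$$ has at least one solution. Let $\alpha\in(0,\|P^{-1}A^TA\|^{-1}]$ and $\beta\in(0,\|W\|^{-2})$ (where no upper bound is imposed if the norm in question is $0$), let $k_{\max}\ge 1$ be an integer, let $\gamma_n\ge 0$ for $n\ge 0$, and let $u_0\in\mathbb{R}^d$.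 Put $u_{-1}=u_0$, $v_0^0=0\in\mathbb{R}^{d'}$ and, for $n=0,1,2,\dots$, $$\bar u_n=u_n+\gamma_n(u_n-u_{n-1}),\qquad u_{n+\frac12}=\bar u_n-\alpha P^{-1}\nabla f(\bar u_n),$$ $$v_n^{k+1}=\operatorname{prox}_{\beta\alpha^{-1}h^*}\big(v_n^k+\beta\alpha^{-1}Wu_n^k\big)\quad (k=0,\dots,k_{\max}-1),\qquad u_n^k=u_{n+\frac12}-\alpha W^Tv_n^k\quad(k=0,\dots,k_{\max}),$$ $$v_{n+1}^0=v_n^{k_{\max}},\qquad u_{n+1}=\frac1{k_{\max}}\sum_{j=1}^{k_{\max}}u_n^j,$$ where $h^*(w)=\sup_{x}\,\langle w,x\rangle-h(x)$ is the convex conjugate of $h$ and $\operatorname{prox}_{\tau\varphi}(a)=\operatorname{argmin}_{x}\ \varphi(x)+\frac1{2\tau}\|x-a\|^2$. Suppose that $\sum_{n=0}^\infty\gamma_n\|u_n-u_{n-1}\|<\infty$. Then: (i) the sequence $\{(u_n,v_n^0)\}_{n\in\mathbb{N}}$ is bounded; (ii) the sequence $\{u_n\}_{n\in\mathbb{N}}$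 converges to a solution of (1). -/

import Mathlib

open scoped Matrix.Norms.L2Operator

namespace PNPD

noncomputable section

/-- Euclidean space `ℝⁿ`. -/
abbrev Vec (n : ℕ) : Type := EuclideanSpace ℝ (Fin n)

/-- The action `u ↦ M u` of a real matrix on Euclidean vectors. -/
def app {m n : ℕ} (M : Matrix (Fin m) (Fin n) ℝ) (u : Vec n) : Vec m :=
  WithLp.toLp 2 (M.mulVec u.ofLp)

/-- The norm `‖u‖_M = √(uᵀ M u)` induced by a symmetric positive definite matrix `M`. -/
def normM {n : ℕ} (M : Matrix (Fin n) (Fin n) ℝ) (u : Vec n) : ℝ :=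
  Real.sqrt (inner ℝ u (app M u))

/-- The domain of an extended-real-valued function. -/
def dom {n : ℕ} (φ : Vec n → EReal) : Set (Vec n) := {x | φ x < ⊤}

/-- `φ : ℝⁿ → ℝ ∪ {∞}` is proper: it never takes the value `-∞` and is finite somewhere. -/
def IsProper {n : ℕ} (φ : Vec n → EReal) : Prop :=
  (∀ x, φ x ≠ ⊥) ∧ (dom φ).Nonempty

/-- `φ` is convex: its epigraph is a convex subset of `ℝⁿ × ℝ`. -/
def IsConvex {n : ℕ} (φ : Vec n → EReal) : Prop :=
  Convex ℝ {p : Vec n × ℝ | φ p.1 ≤ (p.2 : EReal)}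

/-- The convex conjugate `φ*(w) = sup_u ⟨w, u⟩ - φ(u)`. -/
def conjugate {n : ℕ} (φ : Vec n → EReal) (w : Vec n) : EReal :=
  ⨆ u : Vec n, ((inner ℝ w u : ℝ) : EReal) - φ u

/-- The objective `u ↦ φ(u) + ‖u - a‖² / (2 γ)` that defines the proximal point. -/
def proxObjective {n : ℕ} (γ : ℝ) (φ : Vec n → EReal) (a u : Vec n) : EReal :=
  φ u + ((1 / (2 * γ) * ‖u - a‖ ^ 2 : ℝ) : EReal)

/-- The proximal operator `prox_{γ φ}(a) = argmin_u φ(u) + ‖u - a‖² / (2 γ)`. For `γ > 0` and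
`φ` proper, convex and lower semicontinuous, the minimizer exists and is unique. -/
def prox {n : ℕ} (γ : ℝ) (φ : Vec n → EReal) (a : Vec n) : Vec n :=
  Classical.epsilon fun p => IsMinOn (proxObjective γ φ a) Set.univ p

/-- The data fidelity term `f(u) = ½ ‖A u - b‖²`. -/
def fidelity {s d : ℕ} (A : Matrix (Fin s) (Fin d) ℝ) (b : Vec s) (u : Vec d) : ℝ :=
  1 / 2 * ‖app A u - b‖ ^ 2

/-- The objective `½ ‖A u - b‖²_{S⁻¹} + h(W u)` of the preconditioned problem. -/
def objective {s d m : ℕ} (A : Matrix (Fin s) (Fin d) ℝ) (b : Vec s)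
    (S : Matrix (Fin s) (Fin s) ℝ) (W : Matrix (Fin m) (Fin d) ℝ) (h : Vec m → EReal)
    (u : Vec d) : EReal :=
  ((1 / 2 * normM S⁻¹ (app A u - b) ^ 2 : ℝ) : EReal) + h (app W u)

/-- `u` is a (global) solution of `argmin ½ ‖A u - b‖²_{S⁻¹} + h(W u)`. -/
def IsSolution {s d m : ℕ} (A : Matrix (Fin s) (Fin d) ℝ) (b : Vec s)
    (S : Matrix (Fin s) (Fin s) ℝ) (W : Matrix (Fin m) (Fin d) ℝ) (h : Vec m → EReal)
    (u : Vec d) : Prop :=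
  IsMinOn (objective A b S W h) Set.univ u

/-- The primal point `x - α Wᵀ v` of the inner loop, where `x = u_{n+1/2}`. -/
def innerPrimal {d m : ℕ} (W : Matrix (Fin m) (Fin d) ℝ) (α : ℝ) (x : Vec d) (v : Vec m) :
    Vec d :=
  x - α • app W.transpose v

/-- The dual sequence of the inner loop, started at `v⁰`, with `x = u_{n+1/2}`:
`v^{k+1} = prox_{β α⁻¹ h*}(v^k + β α⁻¹ W (x - α Wᵀ v^k))`. -/
def innerDual {d m : ℕ} (W : Matrix (Fin m) (Fin d) ℝ) (h : Vec m → EReal) (α β : ℝ)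
    (x : Vec d) (v₀ : Vec m) : ℕ → Vec m
  | 0 => v₀
  | k + 1 =>
    prox (β * α⁻¹) (conjugate h)
      (innerDual W h α β x v₀ k +
        (β * α⁻¹) • app W (innerPrimal W α x (innerDual W h α β x v₀ k)))

/-- The state `(u_{n-1}, u_n, v_n^0)` at the start of the `n`-th outer iteration. -/
structure State (d m : ℕ) where
  /-- `u_{n-1}` -/
  uPrev : Vec d
  /-- `u_n` -/
  u : Vec d
  /-- `v_n^0` -/
  v : Vec m

/-- The point `u_{n+1/2} = ū - α P⁻¹ ∇f(ū)`, where `ū = u_n + γ_n (u_n - u_{n-1})`. -/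
def halfStep {s d : ℕ} (A : Matrix (Fin s) (Fin d) ℝ) (b : Vec s)
    (P : Matrix (Fin d) (Fin d) ℝ) (α γ : ℝ) (uPrev u : Vec d) : Vec d :=
  (u + γ • (u - uPrev)) - α • app P⁻¹ (gradient (fidelity A b) (u + γ • (u - uPrev)))

/-- One outer iteration: `v_{n+1}^0 = v_n^{kmax}` and
`u_{n+1} = (1 / kmax) ∑_{j=1}^{kmax} u_n^j`, where `u_n^j = u_{n+1/2} - α Wᵀ v_n^j`. -/
def step {s d m : ℕ} (A : Matrix (Fin s) (Fin d) ℝ) (b : Vec s)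
    (P : Matrix (Fin d) (Fin d) ℝ) (W : Matrix (Fin m) (Fin d) ℝ) (h : Vec m → EReal)
    (α β : ℝ) (kmax : ℕ) (γ : ℝ) (σ : State d m) : State d m where
  uPrev := σ.u
  u := (1 / (kmax : ℝ)) • ∑ j ∈ Finset.Icc 1 kmax,
    innerPrimal W α (halfStep A b P α γ σ.uPrev σ.u)
      (innerDual W h α β (halfStep A b P α γ σ.uPrev σ.u) σ.v j)
  v := innerDual W h α β (halfStep A b P α γ σ.uPrev σ.u) σ.v kmax

/-- The states generated by the method from `u_{-1} = u_0` and `v_0^0 = 0`. -/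
def iterate {s d m : ℕ} (A : Matrix (Fin s) (Fin d) ℝ) (b : Vec s)
    (P : Matrix (Fin d) (Fin d) ℝ) (W : Matrix (Fin m) (Fin d) ℝ) (h : Vec m → EReal)
    (α β : ℝ) (kmax : ℕ) (γ : ℕ → ℝ) (u₀ : Vec d) : ℕ → State d m
  | 0 => ⟨u₀, u₀, 0⟩
  | n + 1 => step A b P W h α β kmax (γ n) (iterate A b P W h α β kmax γ u₀ n)

end

end PNPD

/-! The identity `P⁻¹ * Aᵀ = Aᵀ * S⁻¹` turns the preconditioned gradient into `H u - q` with `H = Aᵀ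
S⁻¹ A` and `q = Aᵀ S⁻¹ b`, which is the gradient of the quadratic term of (1). Moreover `H` is
symmetric and positive semidefinite, and `α ‖H‖ ≤ 1` makes it cocoercive.

Optimality for (1) means that there is a dual vector `v ∈ ∂h(W u)` with `Wᵀ v = -(H u - q)`.
Sufficiency is the subgradient inequality. Necessity is Fenchel–Rockafellar duality, where the
relative interior condition enters through a separation argument based on the M. Riesz extension
theorem. Moreau's decomposition rewrites each dual prox step as an inclusion in `∂h`, so the rest
needs only monotonicity and closedness of `∂h`.

Convergence is a quasi-Fejér argument. For every saddle point `(u₀, v₀)`, the distance `√(α τ⁻¹ ‖v -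
v₀‖² + K ‖u - u₀‖²)`, with `τ = β α⁻¹` and `K = kmax`, decreases up to the errors `√K ‖ū_n - u_n‖`,
which are summable (`inner_loop_inequality`, `exists_tendsto_of_sq_add_le`). Hence the iterates are
bounded and the decrease terms vanish, so any cluster point is again a saddle point. The distance to
that point converges, and it tends to zero along a subsequence, so it tends to zero. -/

namespace PNPD

open Filter Topology ContinuousLinearMap

/-! ### Subgradients and proximal points of extended-real convex functions -/

section ConvexAnalysis

variable {F : Type*} [NormedAddCommGroup F] [InnerProductSpace ℝ F]

/-- `v` is a subgradient of `φ` at `p`. Testing only against real upper bounds of the values of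
`φ` avoids subtraction in `EReal`. -/
def IsSubgradient (φ : F → EReal) (p v : F) : Prop :=
  ∀ (y : F) (t : ℝ), φ y ≤ t → φ p ≤ ((t - inner ℝ v (y - p) : ℝ) : EReal)

theorem IsSubgradient.exists_eq_coe {φ : F → EReal} (hbot : ∀ x, φ x ≠ ⊥)
    (hdom : ∃ x, φ x < ⊤) {p v : F} (hv : IsSubgradient φ p v) : ∃ r : ℝ, φ p = r := by
  obtain ⟨y, hy⟩ := hdom
  have h1 := hv y (φ y).toReal (EReal.le_coe_toReal hy.ne)
  have h2 : φ p ≠ ⊤ := (h1.trans_lt (EReal.coe_lt_top _)).ne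
  exact ⟨(φ p).toReal, (EReal.coe_toReal h2 (hbot p)).symm⟩

theorem IsSubgradient.inner_sub_nonneg {φ : F → EReal} (hbot : ∀ x, φ x ≠ ⊥)
    (hdom : ∃ x, φ x < ⊤) {p v q w : F} (hv : IsSubgradient φ p v)
    (hw : IsSubgradient φ q w) : 0 ≤ inner ℝ (v - w) (p - q) := by
  obtain ⟨r, hr⟩ := hv.exists_eq_coe hbot hdom
  obtain ⟨r', hr'⟩ := hw.exists_eq_coe hbot hdom
  have h1 := hv q r' hr'.le
  have h2 := hw p r hr.le
  rw [hr, EReal.coe_le_coe_iff] at h1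
  rw [hr', EReal.coe_le_coe_iff] at h2
  simp only [inner_sub_left, inner_sub_right] at *
  linarith

theorem isClosed_real_epigraph {F : Type*} [TopologicalSpace F] {φ : F → EReal}
    (hlsc : LowerSemicontinuous φ) : IsClosed {p : F × ℝ | φ p.1 ≤ (p.2 : EReal)} :=
  hlsc.isClosed_epigraph.preimage
    (continuous_fst.prodMk (continuous_coe_real_ereal.comp continuous_snd))

/-- The graph of the subdifferential is closed because the epigraph is. -/
theorem isSubgradient_of_tendsto {φ : F → EReal} (hlsc : LowerSemicontinuous φ)
    {p v : ℕ → F} {p' v' : F} (hp : Tendsto p atTop (𝓝 p')) (hv : Tendsto v atTop (𝓝 v'))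
    (h : ∀ n, IsSubgradient φ (p n) (v n)) : IsSubgradient φ p' v' := by
  intro y t hy
  have hlim : Tendsto (fun n => (p n, t - inner ℝ (v n) (y - p n))) atTop
      (𝓝 (p', t - inner ℝ v' (y - p'))) :=
    hp.prodMk_nhds (tendsto_const_nhds.sub (hv.inner (tendsto_const_nhds.sub hp)))
  exact (isClosed_real_epigraph hlsc).mem_of_tendsto hlim
    (Eventually.of_forall fun n => h n y t hy)

/-- A proper lower semicontinuous convex function has a continuous affine minorant. -/
theorem exists_affine_minorant [CompleteSpace F] {φ : F → EReal} (hbot : ∀ x, φ x ≠ ⊥)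
    (hdom : ∃ x, φ x < ⊤) (hlsc : LowerSemicontinuous φ)
    (hconv : Convex ℝ {p : F × ℝ | φ p.1 ≤ (p.2 : EReal)}) :
    ∃ (w : F) (c : ℝ), ∀ (y : F) (t : ℝ), φ y ≤ t → inner ℝ w y + c ≤ t := by
  obtain ⟨x, hx⟩ := hdom
  obtain ⟨r, hr⟩ : ∃ r : ℝ, φ x = r :=
    ⟨(φ x).toReal, (EReal.coe_toReal hx.ne (hbot x)).symm⟩
  have hnot : (x, r - 1) ∉ {p : F × ℝ | φ p.1 ≤ (p.2 : EReal)} := by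
    simp only [Set.mem_ofPred_eq, hr, EReal.coe_le_coe_iff]
    linarith
  obtain ⟨f, u, hfu, hux⟩ :=
    geometric_hahn_banach_closed_point hconv (isClosed_real_epigraph hlsc) hnot
  have hsplit : ∀ (y : F) (t : ℝ), f (y, t) = f (y, 0) + t * f (0, 1) := by
    intro y t
    have : (y, t) = (y, (0 : ℝ)) + t • ((0 : F), (1 : ℝ)) := by simp
    rw [this, map_add, map_smul, smul_eq_mul]
  have hxr : f (x, r) < u := hfu (x, r) (by simp [hr])
  rw [hsplit] at hxr hux
  -- The separating hyperplane is not vertical: the separated points `(x, r)` and `(x, r - 1)`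
  -- differ only in height.
  have hs : f (0, 1) < 0 := by linarith
  let g : F →L[ℝ] ℝ := f.comp (ContinuousLinearMap.inl ℝ F ℝ)
  have hg : ∀ y, inner ℝ ((InnerProductSpace.toDual ℝ F).symm g) y = f (y, 0) := fun y => by
    rw [InnerProductSpace.toDual_symm_apply]; simp [g]
  refine ⟨(-(f (0, 1))⁻¹) • (InnerProductSpace.toDual ℝ F).symm g, u * (f (0, 1))⁻¹, ?_⟩
  intro y t hyt
  have h1 : f (y, t) < u := hfu (y, t) hyt
  rw [hsplit] at h1
  rw [real_inner_smul_left, hg]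
  have h2 : t = (t * f (0, 1)) * (f (0, 1))⁻¹ := by
    rw [mul_assoc, mul_inv_cancel₀ hs.ne, mul_one]
  have h3 : (f (0, 1))⁻¹ < 0 := inv_lt_zero.2 hs
  nlinarith

/-- First-order condition along a segment: dividing by `l` and letting `l` tend to zero removes the
quadratic term. -/
theorem nonneg_of_forall_mul_add_sq_mul_nonneg {a b : ℝ}
    (h : ∀ l : ℝ, 0 < l → l ≤ 1 → 0 ≤ l * b + l ^ 2 * a) : 0 ≤ b := by
  by_contra! hb
  have ha : 0 < |a| - b := by have := abs_nonneg a; linarith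
  have hl : 0 < -b / (|a| - b) := div_pos (by linarith) ha
  have h1 := h _ hl ((div_le_one ha).2 (by have := abs_nonneg a; linarith))
  have h2 : -b / (|a| - b) * (|a| - b) = -b := div_mul_cancel₀ _ ha.ne'
  set l := -b / (|a| - b)
  have h3 : l * a ≤ l * |a| := mul_le_mul_of_nonneg_left (le_abs_self a) hl.le
  have h4 : 0 ≤ l * (b + l * a) := by nlinarith
  have h5 : 0 ≤ b + l * a := nonneg_of_mul_nonneg_right h4 hl
  nlinarith

/-- Existence of the proximal point of `φ / τ` at `c`, through its optimality condition. -/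
theorem exists_isSubgradient_smul_sub [FiniteDimensional ℝ F] {φ : F → EReal}
    (hbot : ∀ x, φ x ≠ ⊥) (hdom : ∃ x, φ x < ⊤) (hlsc : LowerSemicontinuous φ)
    (hconv : Convex ℝ {p : F × ℝ | φ p.1 ≤ (p.2 : EReal)}) {τ : ℝ} (hτ : 0 < τ) (c : F) :
    ∃ p, IsSubgradient φ p (τ • (c - p)) := by
  have : CompleteSpace F := FiniteDimensional.complete ℝ F
  have : ProperSpace F := FiniteDimensional.proper ℝ F
  obtain ⟨w, k, hwk⟩ := exists_affine_minorant hbot hdom hlsc hconv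
  obtain ⟨x, hx⟩ := hdom
  -- Minimizing the continuous function `G` over the closed epigraph replaces minimizing a lower
  -- semicontinuous `EReal`-valued function; the affine minorant makes the sublevel set compact.
  let G : F × ℝ → ℝ := fun p => p.2 + τ / 2 * ‖p.1 - c‖ ^ 2
  have hG : Continuous G := by fun_prop
  let M := G (x, (φ x).toReal)
  let K : Set (F × ℝ) := {p | φ p.1 ≤ (p.2 : EReal)} ∩ {p | G p ≤ M}
  have hxK : (x, (φ x).toReal) ∈ K := ⟨EReal.le_coe_toReal hx.ne, le_refl M⟩
  have hclosed : IsClosed K :=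
    (isClosed_real_epigraph hlsc).inter (isClosed_le hG continuous_const)
  have hbdd : Bornology.IsBounded K := by
    obtain ⟨D, hD⟩ : ∃ D : ℝ, D = M - k - inner ℝ w c + τ⁻¹ * ‖w‖ ^ 2 := ⟨_, rfl⟩
    have hdist : ∀ p ∈ K, ‖p.1 - c‖ ≤ 4 * τ⁻¹ * D + 1 := by
      rintro ⟨y, t⟩ ⟨h1, h2⟩
      have h3 := hwk y t h1
      have h4 : t + τ / 2 * ‖y - c‖ ^ 2 ≤ M := h2
      have h5 : -(‖w‖ * ‖y - c‖) ≤ inner ℝ w (y - c) :=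
        (abs_le.1 (abs_real_inner_le_norm w (y - c))).1
      rw [inner_sub_right] at h5
      have h6 : ‖w‖ * ‖y - c‖ ≤ τ⁻¹ * ‖w‖ ^ 2 + τ / 4 * ‖y - c‖ ^ 2 := by
        have h7 : τ⁻¹ * τ = 1 := inv_mul_cancel₀ hτ.ne'
        have h8 : 0 < τ⁻¹ := inv_pos.2 hτ
        have h9 : τ⁻¹ * ‖w‖ ^ 2 + τ / 4 * ‖y - c‖ ^ 2 - ‖w‖ * ‖y - c‖
            = τ⁻¹ * (‖w‖ - τ / 2 * ‖y - c‖) ^ 2 := by field_simp; ring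
        nlinarith [mul_nonneg h8.le (sq_nonneg (‖w‖ - τ / 2 * ‖y - c‖))]
      have h7 : τ / 4 * ‖y - c‖ ^ 2 ≤ D := by rw [hD]; linarith
      have h8 : ‖y - c‖ ^ 2 ≤ 4 * τ⁻¹ * D := by
        have : ‖y - c‖ ^ 2 = 4 * τ⁻¹ * (τ / 4 * ‖y - c‖ ^ 2) := by field_simp
        rw [this]
        exact mul_le_mul_of_nonneg_left h7 (by positivity)
      show ‖y - c‖ ≤ _
      nlinarith [sq_nonneg (‖y - c‖ - 1), norm_nonneg (y - c)]
    obtain ⟨B, hB⟩ : ∃ B : ℝ, B = 4 * τ⁻¹ * D + 1 := ⟨_, rfl⟩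
    rw [← hB] at hdist
    refine (Bornology.IsBounded.prod (Metric.isBounded_closedBall (x := c) (r := B))
      (Metric.isBounded_Icc (-(‖w‖ * B) + inner ℝ w c + k) M)).subset ?_
    rintro ⟨y, t⟩ hp
    have h1 : ‖y - c‖ ≤ B := hdist _ hp
    have h3 := hwk y t hp.1
    have h4 : t + τ / 2 * ‖y - c‖ ^ 2 ≤ M := hp.2
    have h5 : -(‖w‖ * ‖y - c‖) ≤ inner ℝ w (y - c) :=
      (abs_le.1 (abs_real_inner_le_norm w (y - c))).1
    rw [inner_sub_right] at h5
    have h6 : ‖w‖ * ‖y - c‖ ≤ ‖w‖ * B := mul_le_mul_of_nonneg_left h1 (norm_nonneg w)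
    have h7 : 0 ≤ τ / 2 * ‖y - c‖ ^ 2 := by positivity
    exact ⟨mem_closedBall_iff_norm.2 h1, by linarith, by linarith⟩
  obtain ⟨⟨p, r⟩, hpK, hmin⟩ :=
    (Metric.isCompact_of_isClosed_isBounded hclosed hbdd).exists_isMinOn ⟨_, hxK⟩
      hG.continuousOn
  have hmin' : ∀ (y : F) (t : ℝ), φ y ≤ t → G (p, r) ≤ G (y, t) := by
    intro y t hyt
    by_cases hM : G (y, t) ≤ M
    · exact hmin ⟨hyt, hM⟩
    · exact le_trans hpK.2 (not_le.1 hM).le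
  refine ⟨p, fun y t hyt => hpK.1.trans (EReal.coe_le_coe_iff.2 ?_)⟩
  rw [← sub_nonneg]
  refine nonneg_of_forall_mul_add_sq_mul_nonneg (a := τ / 2 * ‖y - p‖ ^ 2) fun l hl hl1 => ?_
  -- Compare the minimizer with points of the segment from `(p, r)` to `(y, t)`.
  have hmem := hconv hpK.1 (show (y, t) ∈ {p : F × ℝ | φ p.1 ≤ (p.2 : EReal)} from hyt)
    (sub_nonneg.2 hl1) hl.le (sub_add_cancel 1 l)
  have h2 := hmin' _ _ hmem
  have h3 : (1 - l) • p + l • y - c = (p - c) + l • (y - p) := by module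
  simp only [G, Prod.fst_add, Prod.snd_add, Prod.smul_fst, Prod.smul_snd, smul_eq_mul] at h2
  rw [h3, norm_add_sq_real, norm_smul, mul_pow, Real.norm_eq_abs, sq_abs,
    real_inner_smul_right] at h2
  have h4 : inner ℝ (τ • (c - p)) (y - p) = -(τ * inner ℝ (p - c) (y - p)) := by
    rw [real_inner_smul_left, ← neg_sub p c, inner_neg_left]; ring
  rw [h4]
  linarith

end ConvexAnalysis

/-! ### Conjugates and the Moreau decomposition -/

theorem coe_inner_sub_le_conjugate {n : ℕ} {φ : Vec n → EReal} {p : Vec n} {r : ℝ}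
    (hr : φ p = r) (w : Vec n) : ((inner ℝ w p - r : ℝ) : EReal) ≤ conjugate φ w := by
  rw [EReal.coe_sub, ← hr]
  exact le_iSup (fun u => ((inner ℝ w u : ℝ) : EReal) - φ u) p

theorem IsSubgradient.conjugate_eq {n : ℕ} {φ : Vec n → EReal} (hbot : ∀ x, φ x ≠ ⊥)
    {p v : Vec n} {r : ℝ} (hr : φ p = r) (hv : IsSubgradient φ p v) :
    conjugate φ v = ((inner ℝ v p - r : ℝ) : EReal) := by
  refine le_antisymm (iSup_le fun y => ?_) (coe_inner_sub_le_conjugate hr v)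
  by_cases hy : φ y = ⊤
  · simp [hy]
  · have ht : φ y = ((φ y).toReal : EReal) := (EReal.coe_toReal hy (hbot y)).symm
    have h1 := hv y _ ht.le
    rw [hr, EReal.coe_le_coe_iff, inner_sub_right] at h1
    rw [ht, ← EReal.coe_sub, EReal.coe_le_coe_iff]
    linarith

/-- Moreau decomposition: `(a - prox_{τ φ*} a) / τ` is a point at which `prox_{τ φ*} a` is a
subgradient of `φ`. -/
theorem isSubgradient_prox_conjugate {n : ℕ} {φ : Vec n → EReal} (hproper : IsProper φ)
    (hconv : IsConvex φ) (hlsc : LowerSemicontinuous φ) {τ : ℝ} (hτ : 0 < τ) (a : Vec n) :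
    IsSubgradient φ (τ⁻¹ • (a - prox τ (conjugate φ) a)) (prox τ (conjugate φ) a) := by
  obtain ⟨hbot, hdom⟩ := hproper
  obtain ⟨p, hp⟩ := exists_isSubgradient_smul_sub hbot hdom hlsc hconv hτ (τ⁻¹ • a)
  obtain ⟨r, hr⟩ := hp.exists_eq_coe hbot hdom
  have hv : τ • (τ⁻¹ • a - p) = a - τ • p := by rw [smul_sub, smul_inv_smul₀ hτ.ne']
  rw [hv] at hp
  -- `v` is the candidate for the proximal point of the conjugate at `a`, and `v ∈ ∂φ(p)`.
  obtain ⟨v, rfl⟩ : ∃ v, a = v + τ • p := ⟨a - τ • p, by abel⟩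
  rw [add_sub_cancel_right] at hp
  have hobj : proxObjective τ (conjugate φ) (v + τ • p) v
      = ((inner ℝ v p - r + 1 / (2 * τ) * ‖v - (v + τ • p)‖ ^ 2 : ℝ) : EReal) := by
    rw [proxObjective, hp.conjugate_eq hbot hr, ← EReal.coe_add]
  -- Fenchel's inequality at `p` alone gives quadratic growth at `v`, hence both minimality and
  -- uniqueness; uniqueness identifies the point chosen by `Classical.epsilon`.
  have hgrow : ∀ w, ((inner ℝ v p - r + 1 / (2 * τ) * ‖v - (v + τ • p)‖ ^ 2
      + 1 / (2 * τ) * ‖w - v‖ ^ 2 : ℝ) : EReal)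
      ≤ proxObjective τ (conjugate φ) (v + τ • p) w := by
    intro w
    refine le_trans (le_of_eq ?_)
      (add_le_add_left (coe_inner_sub_le_conjugate hr w) _)
    rw [← EReal.coe_add, EReal.coe_eq_coe_iff]
    have h1 : w - (v + τ • p) = (w - v) - τ • p := by abel
    have h2 : v - (v + τ • p) = -(τ • p) := by abel
    rw [h1, h2, norm_neg, norm_sub_sq_real (w - v), real_inner_smul_right, inner_sub_left]
    field_simp
    ring
  have hmin : IsMinOn (proxObjective τ (conjugate φ) (v + τ • p)) Set.univ v := by
    intro w _
    refine le_trans ?_ (hgrow w)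
    rw [hobj, EReal.coe_le_coe_iff]
    have : 0 ≤ 1 / (2 * τ) * ‖w - v‖ ^ 2 := by positivity
    linarith
  have hprox : prox τ (conjugate φ) (v + τ • p) = v := by
    have hmin' : IsMinOn (proxObjective τ (conjugate φ) (v + τ • p)) Set.univ
        (prox τ (conjugate φ) (v + τ • p)) := Classical.epsilon_spec
          (p := fun q => IsMinOn (proxObjective τ (conjugate φ) (v + τ • p)) Set.univ q) ⟨v, hmin⟩
    have h1 := (hgrow _).trans (hmin' (Set.mem_univ v))
    rw [hobj, EReal.coe_le_coe_iff] at h1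
    have h2 : 1 / (2 * τ) * ‖prox τ (conjugate φ) (v + τ • p) - v‖ ^ 2 ≤ 0 := by linarith
    have h3 : 0 < 1 / (2 * τ) := by positivity
    have h4 := nonpos_of_mul_nonpos_right h2 h3
    exact sub_eq_zero.1 (norm_eq_zero.1 (pow_eq_zero_iff two_ne_zero |>.1
      (le_antisymm h4 (sq_nonneg _))))
  rw [hprox, add_sub_cancel_left, inv_smul_smul₀ hτ.ne']
  exact hp

/-! ### Separation from a subspace that meets the relative interior -/

section Separation

variable {F : Type*} [NormedAddCommGroup F] [InnerProductSpace ℝ F]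

theorem exists_pos_add_smul_mem_of_mem_intrinsicInterior {s : Set F} {x v : F}
    (hx : x ∈ intrinsicInterior ℝ s) (hv : v ∈ vectorSpan ℝ s) :
    ∃ l : ℝ, 0 < l ∧ x + l • v ∈ s := by
  obtain ⟨y, hy, rfl⟩ := mem_intrinsicInterior.1 hx
  rw [← direction_affineSpan] at hv
  let c : ℝ → affineSpan ℝ s := fun l =>
    ⟨l • v +ᵥ (y : F), AffineSubspace.vadd_mem_of_mem_direction
      (Submodule.smul_mem _ l hv) y.2⟩
  have hc : Continuous c := by
    refine Continuous.subtype_mk ?_ _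
    simp only [vadd_eq_add]
    fun_prop
  have h0 : c 0 = y := Subtype.ext (by simp [c])
  have h1 : ∀ᶠ l in 𝓝 (0 : ℝ), c l ∈ interior (Subtype.val ⁻¹' s) :=
    hc.continuousAt.eventually (by rw [h0]; exact isOpen_interior.mem_nhds hy)
  obtain ⟨l, hl, hl0⟩ := ((h1.filter_mono nhdsWithin_le_nhds).and
    (self_mem_nhdsWithin (a := (0 : ℝ)) (s := Set.Ioi 0))).exists
  refine ⟨l, hl0, ?_⟩
  have := interior_subset hl
  simpa [c, add_comm] using this

/-- A convex set in `F × ℝ` that lies above `0` over a subspace `R` meeting the relative interior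
of its projection lies above a linear function that vanishes on `R`. -/
theorem exists_mem_orthogonal_forall_inner_le [FiniteDimensional ℝ F] {C : Set (F × ℝ)}
    (hC : Convex ℝ C) {R : Submodule ℝ F} {x : F} (hxR : x ∈ R)
    (hx : x ∈ intrinsicInterior ℝ (Prod.fst '' C)) (hnonneg : ∀ p ∈ C, p.1 ∈ R → 0 ≤ p.2) :
    ∃ z ∈ Rᗮ, ∀ p ∈ C, inner ℝ z p.1 ≤ p.2 := by
  have : CompleteSpace F := FiniteDimensional.complete ℝ F
  let U := vectorSpan ℝ (Prod.fst '' C) ⊔ R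
  have hxC : x ∈ Prod.fst '' C := intrinsicInterior_subset hx
  have hsub : ∀ p ∈ C, p.1 - x ∈ U := fun p hp =>
    Submodule.mem_sup_left (vsub_mem_vectorSpan ℝ (Set.mem_image_of_mem _ hp) hxC)
  -- The cone generated by `C - (x, 0)`, enlarged by `Uᗮ` so that together with `R × ℝ` it reaches
  -- every direction. The height functional on `R × ℝ` is then extended to one that is nonnegative
  -- on `K`.
  let K : PointedCone ℝ (F × ℝ) :=
    { carrier := {q | ∃ l : ℝ, 0 ≤ l ∧ ∃ p ∈ C, ∃ n ∈ Uᗮ, q = (l • (p.1 - x) + n, l * p.2)}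
      zero_mem' := by
        obtain ⟨p, hp, -⟩ := hxC
        exact ⟨0, le_rfl, p, hp, 0, Submodule.zero_mem _, by simp; rfl⟩
      smul_mem' := by
        rintro ⟨c, hc⟩ _ ⟨l, hl, p, hp, n, hn, rfl⟩
        refine ⟨c * l, mul_nonneg hc hl, p, hp, c • n, Submodule.smul_mem _ _ hn, ?_⟩
        rw [Nonneg.mk_smul, Prod.smul_mk, smul_add, smul_smul, smul_eq_mul, mul_assoc]
      add_mem' := by
        rintro _ _ ⟨l, hl, p, hp, n, hn, rfl⟩ ⟨l', hl', p', hp', n', hn', rfl⟩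
        rcases hl.eq_or_lt with rfl | hl0
        · exact ⟨l', hl', p', hp', n + n', Submodule.add_mem _ hn hn', by simp; abel⟩
        have hpos : 0 < l + l' := by linarith
        refine ⟨l + l', hpos.le, (l / (l + l')) • p + (l' / (l + l')) • p',
          hC hp hp' (by positivity) (by positivity) (by field_simp), n + n',
          Submodule.add_mem _ hn hn', ?_⟩
        have h1 : (l + l') * (l / (l + l')) = l := by field_simp
        have h2 : (l + l') * (l' / (l + l')) = l' := by field_simp
        ext
        · simp only [Prod.fst_add, Prod.smul_fst, smul_sub, smul_add, smul_smul, h1, h2, add_smul]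
          simp only [← smul_sub]
          module
        · simp only [Prod.snd_add, Prod.smul_snd, smul_eq_mul, mul_add, ← mul_assoc, h1, h2] }
  let f : F × ℝ →ₗ.[ℝ] ℝ := ⟨R.prod ⊤, (LinearMap.snd ℝ F ℝ).domRestrict _⟩
  have hf : ∀ q : f.domain, f q = (q : F × ℝ).2 := fun q => rfl
  obtain ⟨g, hg, hgK⟩ := riesz_extension K f
    (by
      rintro ⟨_, hqR⟩ ⟨l, hl, p, hp, n, hn, rfl⟩
      rw [hf]
      show 0 ≤ l * p.2
      have h1 : l • (p.1 - x) + n ∈ R := hqR.1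
      -- The added directions do no harm: over `R`, the component `n` lies in both `U` and `Uᗮ`, so
      -- it is zero.
      have h2 : n ∈ U := by
        have h3 := Submodule.sub_mem U (Submodule.mem_sup_right h1)
          (Submodule.smul_mem U l (hsub p hp))
        simpa using h3
      have h4 : n = 0 := by
        have := Submodule.inner_right_of_mem_orthogonal h2 hn
        exact inner_self_eq_zero.1 this
      rcases hl.eq_or_lt with rfl | hl0
      · simp
      · refine mul_nonneg hl (hnonneg p hp ?_)
        rw [h4, add_zero, Submodule.smul_mem_iff _ hl0.ne'] at h1
        simpa using Submodule.add_mem _ h1 hxR)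
    (by
      rintro ⟨a, c⟩
      obtain ⟨a₁, ha₁, n, hn, rfl⟩ := Submodule.exists_add_mem_mem_orthogonal (K := U) a
      obtain ⟨v, hv, r, hr, rfl⟩ := Submodule.mem_sup.1 ha₁
      -- Relative interiority of `x`: a small step along `v` stays in the projection of `C`, and
      -- scaling by `l⁻¹` recovers `v`.
      obtain ⟨l, hl, p, hp, hpl⟩ := exists_pos_add_smul_mem_of_mem_intrinsicInterior hx hv
      refine ⟨⟨(-r, l⁻¹ * p.2 - c), Submodule.neg_mem _ hr, trivial⟩, l⁻¹, by positivity,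
        p, hp, n, hn, ?_⟩
      rw [hpl, add_sub_cancel_left, inv_smul_smul₀ hl.ne']
      ext
      · show -r + (v + r + n) = v + n
        abel
      · simp)
  have hgR : ∀ r ∈ R, ∀ c : ℝ, g (r, c) = c := fun r hr c => hg ⟨(r, c), hr, trivial⟩
  let g' : F →L[ℝ] ℝ := LinearMap.toContinuousLinearMap (g ∘ₗ LinearMap.inl ℝ F ℝ)
  have hg' : ∀ y, inner ℝ ((InnerProductSpace.toDual ℝ F).symm g') y = g (y, 0) := fun y => by
    rw [InnerProductSpace.toDual_symm_apply]; simp [g']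
  refine ⟨-(InnerProductSpace.toDual ℝ F).symm g', ?_, fun p hp => ?_⟩
  · rw [Submodule.mem_orthogonal']
    intro r hr
    rw [inner_neg_left, hg', hgR r hr, neg_zero]
  · have h1 : 0 ≤ g (p.1 - x, p.2) :=
      hgK _ ⟨1, zero_le_one, p, hp, 0, Submodule.zero_mem _, by simp⟩
    have h2 : (p.1 - x, p.2) = (p.1, (0 : ℝ)) + (-x, p.2) := by
      ext
      · simp [sub_eq_add_neg]
      · simp
    rw [h2, map_add, hgR _ (Submodule.neg_mem _ hxR)] at h1
    rw [inner_neg_left, hg']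
    linarith

end Separation

/-! ### Optimality conditions and Fenchel–Rockafellar duality -/

section Duality

variable {E F : Type*} [NormedAddCommGroup E] [InnerProductSpace ℝ E]
  [NormedAddCommGroup F] [InnerProductSpace ℝ F]

/-- First order optimality for the sum of a quadratic function `g` and a convex function. -/
theorem le_add_inner_of_isMinOn {φ : F → EReal}
    (hconv : Convex ℝ {p : F × ℝ | φ p.1 ≤ (p.2 : EReal)}) {W : E →L[ℝ] F} {g Q : E → ℝ}
    {u₀ c : E} (hg : ∀ z, g (u₀ + z) = g u₀ + inner ℝ c z + Q z)
    (hQ : ∀ (l : ℝ) z, Q (l • z) = l ^ 2 * Q z) {r : ℝ} (hr : φ (W u₀) = r)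
    (hmin : IsMinOn (fun u => (g u : EReal) + φ (W u)) Set.univ u₀) (u : E) (t : ℝ)
    (ht : φ (W u) ≤ t) : r ≤ t + inner ℝ c (u - u₀) := by
  rw [← sub_nonneg]
  refine nonneg_of_forall_mul_add_sq_mul_nonneg (a := Q (u - u₀)) fun l hl hl1 => ?_
  have hmem := hconv (show (W u₀, r) ∈ {p : F × ℝ | φ p.1 ≤ (p.2 : EReal)} from hr.le)
    (show (W u, t) ∈ {p : F × ℝ | φ p.1 ≤ (p.2 : EReal)} from ht)
    (sub_nonneg.2 hl1) hl.le (sub_add_cancel 1 l)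
  have h1 : φ (W (u₀ + l • (u - u₀))) ≤ (((1 - l) * r + l * t : ℝ) : EReal) := by
    have h2 : W (u₀ + l • (u - u₀)) = (1 - l) • W u₀ + l • W u := by
      simp only [map_add, map_smul, map_sub]; module
    rw [h2]
    exact hmem
  have h3 : (g u₀ : EReal) + φ (W u₀)
      ≤ (g (u₀ + l • (u - u₀)) : EReal) + φ (W (u₀ + l • (u - u₀))) := hmin (Set.mem_univ _)
  have h4 := h3.trans (add_le_add_right h1 _)
  rw [hr, ← EReal.coe_add, ← EReal.coe_add, EReal.coe_le_coe_iff, hg, hQ,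
    real_inner_smul_right] at h4
  linarith

/-- Existence of a dual solution (Fenchel–Rockafellar duality) under a relative interior
qualification condition. -/
theorem exists_isSubgradient_adjoint_eq_neg [FiniteDimensional ℝ E] [FiniteDimensional ℝ F]
    {φ : F → EReal}
    (hconv : Convex ℝ {p : F × ℝ | φ p.1 ≤ (p.2 : EReal)}) {W : E →L[ℝ] F} {x : E}
    (hx : W x ∈ intrinsicInterior ℝ {y | φ y < ⊤}) {u₀ c : E} {r : ℝ}
    (hr : φ (W u₀) = r)
    (hopt : ∀ (u : E) (t : ℝ), φ (W u) ≤ t → r ≤ t + inner ℝ c (u - u₀)) :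
    ∃ v, IsSubgradient φ (W u₀) v ∧ adjoint W v = -c := by
  -- Moving along the kernel of `W` leaves `φ (W u)` unchanged, so the linear term must vanish
  -- there; hence `c` is in the range of the adjoint.
  have hker : c ∈ (LinearMap.ker (W : E →ₗ[ℝ] F))ᗮ := by
    rw [Submodule.mem_orthogonal']
    intro n hn
    have hn' : W n = 0 := hn
    have h1 := hopt (u₀ + n) r (by rw [map_add, hn', add_zero, hr])
    have h2 := hopt (u₀ - n) r (by rw [map_sub, hn', sub_zero, hr])
    rw [add_sub_cancel_left] at h1
    rw [sub_sub_cancel_left, inner_neg_right] at h2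
    linarith
  rw [LinearMap.orthogonal_ker] at hker
  obtain ⟨w', hw'⟩ := hker
  have hadj : ∀ y u, inner ℝ (adjoint W y) u = inner ℝ y (W u) :=
    fun y u => adjoint_inner_left W u y
  have hw : ∀ u, inner ℝ w' (W u) = inner ℝ c u := by
    intro u
    rw [← hw', LinearMap.adjoint_inner_left]; rfl
  -- The epigraph of `y ↦ φ y - r + ⟨w', y - W u₀⟩`, which is nonnegative on the range of `W` by
  -- `hopt`.
  let C : Set (F × ℝ) := {p | φ p.1 ≤ ((p.2 + r - inner ℝ w' (p.1 - W u₀) : ℝ) : EReal)}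
  have hC : Convex ℝ C := by
    intro p hp q hq a b ha hb hab
    have h1 := hconv
      (show (p.1, p.2 + r - inner ℝ w' (p.1 - W u₀)) ∈ {p : F × ℝ | φ p.1 ≤ (p.2 : EReal)} from hp)
      (show (q.1, q.2 + r - inner ℝ w' (q.1 - W u₀)) ∈ {p : F × ℝ | φ p.1 ≤ (p.2 : EReal)} from hq)
      ha hb hab
    refine le_trans h1 (EReal.coe_le_coe_iff.2 (le_of_eq ?_))
    obtain rfl : b = 1 - a := by linarith
    simp only [Prod.fst_add, Prod.snd_add, Prod.smul_fst, Prod.smul_snd, smul_eq_mul,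
      inner_sub_right, inner_add_right, real_inner_smul_right]
    ring
  have hfst : Prod.fst '' C = {y | φ y < ⊤} := by
    ext y
    constructor
    · rintro ⟨p, hp, rfl⟩
      exact lt_of_le_of_lt hp (EReal.coe_lt_top _)
    · intro hy
      refine ⟨(y, (φ y).toReal - r + inner ℝ w' (y - W u₀)), ?_, rfl⟩
      refine (EReal.le_coe_toReal (ne_of_lt hy)).trans (EReal.coe_le_coe_iff.2 (le_of_eq ?_))
      ring
  rw [← hfst] at hx
  obtain ⟨z, hzR, hz⟩ := exists_mem_orthogonal_forall_inner_le hC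
    (R := LinearMap.range (W : E →ₗ[ℝ] F)) (LinearMap.mem_range_self _ x) hx (by
      rintro ⟨_, t⟩ hp ⟨u, rfl⟩
      have h1 := hopt u _ hp
      change r ≤ t + r - inner ℝ w' (W u - W u₀) + inner ℝ c (u - u₀) at h1
      rw [← map_sub, hw] at h1
      show 0 ≤ t
      linarith)
  have hz0 : ∀ u, inner ℝ z (W u) = 0 := fun u =>
    (Submodule.mem_orthogonal' _ _).1 hzR _ (LinearMap.mem_range_self (W : E →ₗ[ℝ] F) u)
  -- `z` is orthogonal to the range of `W`, so subtracting `w'` from it leaves the adjoint value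
  -- `-c`.
  refine ⟨z - w', fun y t hyt => ?_, ?_⟩
  · rw [hr, EReal.coe_le_coe_iff]
    have h1 := hz (y, t - r + inner ℝ w' (y - W u₀)) (by
      show φ y ≤ _
      refine hyt.trans (EReal.coe_le_coe_iff.2 (le_of_eq ?_))
      show t = t - r + inner ℝ w' (y - W u₀) + r - inner ℝ w' (y - W u₀)
      ring)
    change inner ℝ z y ≤ t - r + inner ℝ w' (y - W u₀) at h1
    rw [inner_sub_left, inner_sub_right z, hz0]
    linarith
  · refine ext_inner_right ℝ fun u => ?_
    rw [hadj, inner_sub_left, hz0, hw, inner_neg_left, zero_sub]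

end Duality

/-! ### Quasi-Fejér monotonicity and convergence of the iteration -/

section Iteration

/-- Convergence of a nonnegative sequence that decreases up to summable errors. -/
theorem exists_tendsto_of_sq_add_le {a D ε : ℕ → ℝ} (ha : ∀ n, 0 ≤ a n) (hD : ∀ n, 0 ≤ D n)
    (hε : ∀ n, 0 ≤ ε n) (hsum : Summable ε)
    (h : ∀ n, a (n + 1) ^ 2 + D n ≤ (a n + ε n) ^ 2) :
    (∃ l, Tendsto a atTop (𝓝 l)) ∧ Tendsto D atTop (𝓝 0) := by
  have hstep : ∀ n, a (n + 1) ≤ a n + ε n := fun n =>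
    abs_le_of_sq_le_sq' (by linarith [h n, hD n]) (add_nonneg (ha n) (hε n)) |>.2
  -- Subtracting the accumulated errors makes the sequence monotone.
  have hanti : Antitone fun n => a n - ∑ i ∈ Finset.range n, ε i :=
    antitone_nat_of_succ_le fun n => by
      rw [Finset.sum_range_succ]
      linarith [hstep n]
  have hbdd : BddBelow (Set.range fun n => a n - ∑ i ∈ Finset.range n, ε i) :=
    ⟨-∑' i, ε i, by
      rintro _ ⟨n, rfl⟩
      have h1 := hsum.sum_le_tsum (Finset.range n) fun i _ => hε i
      have h2 := ha n
      simp only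
      linarith⟩
  have hlim := (tendsto_atTop_ciInf hanti hbdd).add hsum.hasSum.tendsto_sum_nat
  simp only [sub_add_cancel] at hlim
  refine ⟨⟨_, hlim⟩, ?_⟩
  have h1 := ((hlim.add hsum.tendsto_atTop_zero).pow 2).sub
    (((tendsto_add_atTop_iff_nat 1).2 hlim).pow 2)
  rw [add_zero, sub_self] at h1
  exact squeeze_zero hD (fun n => by linarith [h n]) h1

theorem tendsto_zero_of_mul_norm_sq {G : Type*} [SeminormedAddCommGroup G] {e : ℕ → G} {c : ℝ}
    (hc : 0 < c) (h : Tendsto (fun n => c * ‖e n‖ ^ 2) atTop (𝓝 0)) :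
    Tendsto e atTop (𝓝 0) := by
  have h1 := (h.const_mul c⁻¹).sqrt
  simp only [inv_mul_cancel_left₀ hc.ne', Real.sqrt_sq (norm_nonneg _), mul_zero,
    Real.sqrt_zero] at h1
  exact tendsto_zero_iff_norm_tendsto_zero.2 h1

/-- The triangle inequality for the weighted norm `√(X + K Y²)`, squared; it turns the inertial
displacement `s` into an additive error. -/
theorem sqrt_add_mul_add_sq_le {X K Y s : ℝ} (hX : 0 ≤ X) (hK : 0 ≤ K)
    (hs : 0 ≤ s) : X + K * (Y + s) ^ 2 ≤ (√(X + K * Y ^ 2) + √K * s) ^ 2 := by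
  have h1 : √K * Y ≤ √(X + K * Y ^ 2) := by
    refine Real.le_sqrt_of_sq_le ?_
    rw [mul_pow, Real.sq_sqrt hK]
    linarith
  have h2 : √(X + K * Y ^ 2) ^ 2 = X + K * Y ^ 2 := Real.sq_sqrt (by positivity)
  have h3 : √K ^ 2 = K := Real.sq_sqrt hK
  have h4 : √K * Y * (√K * s) ≤ √(X + K * Y ^ 2) * (√K * s) :=
    mul_le_mul_of_nonneg_right h1 (by positivity)
  have h5 : √K * Y * (√K * s) = K * Y * s := by rw [← h3, Real.sqrt_sq (Real.sqrt_nonneg K)]; ring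
  nlinarith

variable {E F : Type*} [NormedAddCommGroup E] [InnerProductSpace ℝ E]
  [NormedAddCommGroup F] [InnerProductSpace ℝ F]

/-- Cocoercivity makes the gradient step nonexpansive, with a decrease that later forces `H (ū_n -
u₀) → 0`. -/
theorem norm_sub_smul_sq_le {H : E →L[ℝ] E} {α : ℝ} (hα : 0 ≤ α)
    (hH : ∀ z, α * ‖H z‖ ^ 2 ≤ inner ℝ (H z) z) (z : E) :
    ‖z - α • H z‖ ^ 2 ≤ ‖z‖ ^ 2 - α * inner ℝ (H z) z := by
  rw [norm_sub_sq_real, real_inner_smul_right, norm_smul, mul_pow, Real.norm_eq_abs, sq_abs,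
    real_inner_comm]
  nlinarith [hH z]

theorem card_mul_norm_average_sq_le {ι : Type*} (s : Finset ι) (hs : s.Nonempty) (e : ι → E)
    (u₀ : E) :
    (s.card : ℝ) * ‖(1 / (s.card : ℝ)) • ∑ i ∈ s, e i - u₀‖ ^ 2 ≤ ∑ i ∈ s, ‖e i - u₀‖ ^ 2 := by
  have hc : (0 : ℝ) < s.card := by exact_mod_cast hs.card_pos
  have h1 : (1 / (s.card : ℝ)) • ∑ i ∈ s, e i - u₀
      = (1 / (s.card : ℝ)) • ∑ i ∈ s, (e i - u₀) := by
    rw [Finset.sum_sub_distrib, Finset.sum_const, smul_sub, ← Nat.cast_smul_eq_nsmul ℝ, smul_smul,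
      one_div_mul_cancel hc.ne', one_smul]
  rw [h1, norm_smul, mul_pow, Real.norm_eq_abs, sq_abs]
  have h2 : ‖∑ i ∈ s, (e i - u₀)‖ ^ 2 ≤ s.card * ∑ i ∈ s, ‖e i - u₀‖ ^ 2 :=
    (pow_le_pow_left₀ (norm_nonneg _) (norm_sum_le _ _) 2).trans sq_sum_le_card_mul_sum_sq
  calc (s.card : ℝ) * ((1 / (s.card : ℝ)) ^ 2 * ‖∑ i ∈ s, (e i - u₀)‖ ^ 2)
      = (1 / (s.card : ℝ)) * ‖∑ i ∈ s, (e i - u₀)‖ ^ 2 := by field_simp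
    _ ≤ (1 / (s.card : ℝ)) * (s.card * ∑ i ∈ s, ‖e i - u₀‖ ^ 2) :=
        mul_le_mul_of_nonneg_left h2 (by positivity)
    _ = _ := by field_simp

variable [CompleteSpace E] [CompleteSpace F]

/-- One dual proximal step decreases the distance to a saddle point. -/
theorem dual_step_inequality {φ : F → EReal} (hbot : ∀ y, φ y ≠ ⊥) (hdom : ∃ y, φ y < ⊤)
    {W : E →L[ℝ] F} {α τ : ℝ} (hα : 0 < α) {x u₀ : E} {w w' v₀ : F}
    (hstep : IsSubgradient φ (τ⁻¹ • (w - w') + W (x - α • adjoint W w)) w')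
    (hv₀ : IsSubgradient φ (W u₀) v₀) :
    α * τ⁻¹ * ‖w' - v₀‖ ^ 2 + α * (τ⁻¹ - α * ‖W‖ ^ 2) * ‖w - w'‖ ^ 2
        + ‖x - α • adjoint W w' - u₀‖ ^ 2 + α ^ 2 * ‖adjoint W (w - v₀)‖ ^ 2
      ≤ α * τ⁻¹ * ‖w - v₀‖ ^ 2 + ‖x - (u₀ + α • adjoint W v₀)‖ ^ 2 := by
  have hmono := hstep.inner_sub_nonneg hbot hdom hv₀
  have hW : ‖adjoint W (w - w')‖ ^ 2 ≤ ‖W‖ ^ 2 * ‖w - w'‖ ^ 2 := by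
    rw [← mul_pow]
    refine pow_le_pow_left₀ (norm_nonneg _) ?_ 2
    simpa using (adjoint W).le_opNorm (w - w')
  -- In the error vectors `δ`, `ε`, `a`, the claim is `2 α` times the monotonicity inequality,
  -- rewritten by polarization, with `‖W* δ‖²` bounded by `hW`.
  obtain ⟨δ, rfl⟩ : ∃ δ, w = w' + δ := ⟨w - w', by abel⟩
  obtain ⟨ε, rfl⟩ : ∃ ε, w' = v₀ + ε := ⟨w' - v₀, by abel⟩
  obtain ⟨a, rfl⟩ : ∃ a, x = u₀ + α • adjoint W v₀ + a :=
    ⟨x - (u₀ + α • adjoint W v₀), by abel⟩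
  have h1 : τ⁻¹ • (v₀ + ε + δ - (v₀ + ε))
      + W (u₀ + α • adjoint W v₀ + a - α • adjoint W (v₀ + ε + δ)) - W u₀
      = τ⁻¹ • δ + W (a - α • adjoint W ε - α • adjoint W δ) := by
    rw [add_sub_cancel_left, add_sub_assoc, ← map_sub]
    congr 2
    simp only [map_add]
    module
  have h2 : u₀ + α • adjoint W v₀ + a - α • adjoint W (v₀ + ε) - u₀ = a - α • adjoint W ε := by
    simp only [map_add]
    module
  have h3 : v₀ + ε + δ - v₀ = ε + δ := by abel
  rw [h1, add_sub_cancel_left, inner_add_right, ← adjoint_inner_left, real_inner_smul_right]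
    at hmono
  rw [add_sub_cancel_left] at hW
  rw [h2, h3]
  simp only [add_sub_cancel_left, map_add]
  simp only [inner_sub_right, real_inner_smul_right, real_inner_self_eq_norm_sq] at hmono
  rw [norm_add_sq_real, norm_add_sq_real, norm_sub_sq_real, norm_smul, mul_pow, Real.norm_eq_abs,
    sq_abs, real_inner_smul_right, real_inner_comm (adjoint W ε) a]
  have h4 := mul_nonneg hα.le hmono
  have h5 := mul_le_mul_of_nonneg_left hW (sq_nonneg α)
  nlinarith

/-- Summing the dual steps of one inner loop. -/
theorem inner_loop_inequality {φ : F → EReal} (hbot : ∀ y, φ y ≠ ⊥) (hdom : ∃ y, φ y < ⊤)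
    {W : E →L[ℝ] F} {α τ : ℝ} (hα : 0 < α) (hτ : α * ‖W‖ ^ 2 ≤ τ⁻¹) {x u₀ : E} {w : ℕ → F}
    {v₀ : F} {K : ℕ} (hK : 1 ≤ K)
    (hstep : ∀ k,
      IsSubgradient φ (τ⁻¹ • (w k - w (k + 1)) + W (x - α • adjoint W (w k))) (w (k + 1)))
    (hv₀ : IsSubgradient φ (W u₀) v₀) :
    α * τ⁻¹ * ‖w K - v₀‖ ^ 2
        + K * ‖(1 / (K : ℝ)) • ∑ j ∈ Finset.Icc 1 K, (x - α • adjoint W (w j)) - u₀‖ ^ 2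
        + (α * (τ⁻¹ - α * ‖W‖ ^ 2) * ‖w 0 - w 1‖ ^ 2 + α ^ 2 * ‖adjoint W (w 0 - v₀)‖ ^ 2)
      ≤ α * τ⁻¹ * ‖w 0 - v₀‖ ^ 2 + K * ‖x - (u₀ + α • adjoint W v₀)‖ ^ 2 := by
  have hsum : ∀ n : ℕ, α * τ⁻¹ * ‖w (n + 1) - v₀‖ ^ 2
      + ∑ j ∈ Finset.Icc 1 (n + 1), ‖x - α • adjoint W (w j) - u₀‖ ^ 2
      + (α * (τ⁻¹ - α * ‖W‖ ^ 2) * ‖w 0 - w 1‖ ^ 2 + α ^ 2 * ‖adjoint W (w 0 - v₀)‖ ^ 2)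
      ≤ α * τ⁻¹ * ‖w 0 - v₀‖ ^ 2 + (n + 1 : ℕ) * ‖x - (u₀ + α • adjoint W v₀)‖ ^ 2 := by
    intro n
    induction n with
    | zero =>
      have h1 := dual_step_inequality hbot hdom hα (hstep 0) hv₀
      simp only [zero_add, Finset.Icc_self, Finset.sum_singleton, Nat.cast_one, one_mul] at h1 ⊢
      linarith
    | succ n ih =>
      have h1 := dual_step_inequality hbot hdom hα (hstep (n + 1)) hv₀
      rw [Finset.sum_Icc_succ_top (by omega)]
      -- The decrease terms of the later steps are dropped; those of the first step suffice for the
      -- limit.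
      have h2 : 0 ≤ α * (τ⁻¹ - α * ‖W‖ ^ 2) * ‖w (n + 1) - w (n + 1 + 1)‖ ^ 2 :=
        mul_nonneg (mul_nonneg hα.le (sub_nonneg.2 hτ)) (sq_nonneg _)
      have h3 : 0 ≤ α ^ 2 * ‖adjoint W (w (n + 1) - v₀)‖ ^ 2 := by positivity
      have h4 : ((n + 1 + 1 : ℕ) : ℝ) = (n + 1 : ℕ) + 1 := by push_cast; ring
      rw [h4, add_mul]
      linarith
  obtain ⟨n, rfl⟩ : ∃ n, K = n + 1 := ⟨K - 1, by omega⟩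
  have h1 := card_mul_norm_average_sq_le (Finset.Icc 1 (n + 1)) ⟨1, by simp⟩
    (fun j => x - α • adjoint W (w j)) u₀
  rw [Nat.card_Icc, Nat.add_sub_cancel] at h1
  linarith [hsum n]

/-- Convergence of the inertial nested primal-dual iteration, in terms of the subgradient
inclusions satisfied by the dual iterates `w n k`. -/
theorem nested_primal_dual_converges [FiniteDimensional ℝ E] [FiniteDimensional ℝ F]
    {φ : F → EReal} (hbot : ∀ y, φ y ≠ ⊥) (hdom : ∃ y, φ y < ⊤)
    (hlsc : LowerSemicontinuous φ) {W : E →L[ℝ] F} {H : E →L[ℝ] E} {q : E}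
    {α τ : ℝ} (hα : 0 < α) (hτ : α * ‖W‖ ^ 2 < τ⁻¹)
    (hH : ∀ z, α * ‖H z‖ ^ 2 ≤ inner ℝ (H z) z) {K : ℕ} (hK : 1 ≤ K)
    {u ubar : ℕ → E} {v : ℕ → F} {w : ℕ → ℕ → F} {x : ℕ → E}
    (hx : ∀ n, x n = ubar n - α • (H (ubar n) - q)) (hw0 : ∀ n, w n 0 = v n)
    (hv : ∀ n, v (n + 1) = w n K)
    (hu : ∀ n, u (n + 1)
      = (1 / (K : ℝ)) • ∑ j ∈ Finset.Icc 1 K, (x n - α • adjoint W (w n j)))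
    (hstep : ∀ n k, IsSubgradient φ
      (τ⁻¹ • (w n k - w n (k + 1)) + W (x n - α • adjoint W (w n k))) (w n (k + 1)))
    (hsum : Summable fun n => ‖ubar n - u n‖)
    (hsaddle : ∃ u₀ v₀, IsSubgradient φ (W u₀) v₀ ∧ adjoint W v₀ = -(H u₀ - q)) :
    Bornology.IsBounded (Set.range fun n => (u n, v n)) ∧
    ∃ u₀ v₀, IsSubgradient φ (W u₀) v₀ ∧ adjoint W v₀ = -(H u₀ - q) ∧
      Tendsto u atTop (𝓝 u₀) := by
  have hKpos : (0 : ℝ) < K := by exact_mod_cast hK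
  have hτpos : 0 < τ⁻¹ := lt_of_le_of_lt (by positivity) hτ
  have hκ : 0 < α * (τ⁻¹ - α * ‖W‖ ^ 2) := mul_pos hα (sub_pos.2 hτ)
  have hmono : ∀ z, 0 ≤ inner ℝ (H z) z := fun z => le_trans (by positivity) (hH z)
  have hfejer : ∀ u₀ v₀, IsSubgradient φ (W u₀) v₀ → adjoint W v₀ = -(H u₀ - q) →
      (∃ l, Tendsto (fun n => √(α * τ⁻¹ * ‖v n - v₀‖ ^ 2 + K * ‖u n - u₀‖ ^ 2)) atTop (𝓝 l)) ∧
      Tendsto (fun n => α * (τ⁻¹ - α * ‖W‖ ^ 2) * ‖v n - w n 1‖ ^ 2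
        + α ^ 2 * ‖adjoint W (v n - v₀)‖ ^ 2
        + K * (α * inner ℝ (H (ubar n - u₀)) (ubar n - u₀))) atTop (𝓝 0) := by
    intro u₀ v₀ hv₀ hadj
    refine exists_tendsto_of_sq_add_le (fun n => Real.sqrt_nonneg _)
      (fun n => ?_) (fun n => mul_nonneg (Real.sqrt_nonneg K) (norm_nonneg (ubar n - u n)))
      (hsum.mul_left _) fun n => ?_
    · have := hmono (ubar n - u₀)
      positivity
    · have h1 := inner_loop_inequality hbot hdom hα hτ.le hK (hstep n) hv₀
      rw [hw0, ← hv, ← hu] at h1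
      -- By the saddle point equation, `u₀ + α W* v₀` is the gradient step from `u₀`.
      have h2 : x n - (u₀ + α • adjoint W v₀) = (ubar n - u₀) - α • H (ubar n - u₀) := by
        rw [hx, hadj, map_sub]
        module
      rw [h2] at h1
      have h3 := mul_le_mul_of_nonneg_left (norm_sub_smul_sq_le hα.le hH (ubar n - u₀)) hKpos.le
      have h4 : ‖ubar n - u₀‖ ≤ ‖u n - u₀‖ + ‖ubar n - u n‖ := by
        rw [add_comm]
        exact norm_sub_le_norm_sub_add_norm_sub _ _ _
      have h5 := mul_le_mul_of_nonneg_left (pow_le_pow_left₀ (norm_nonneg _) h4 2) hKpos.le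
      have h6 := sqrt_add_mul_add_sq_le (X := α * τ⁻¹ * ‖v n - v₀‖ ^ 2) (by positivity) hKpos.le
        (Y := ‖u n - u₀‖) (norm_nonneg (ubar n - u n))
      rw [Real.sq_sqrt (by positivity)]
      linarith
  obtain ⟨u₀, v₀, hv₀, hadj⟩ := hsaddle
  obtain ⟨⟨l, hl⟩, hD⟩ := hfejer u₀ v₀ hv₀ hadj
  have hbdd : Bornology.IsBounded (Set.range fun n => (u n, v n)) := by
    obtain ⟨B, hB⟩ := hl.bddAbove_range
    have hB' : ∀ n, α * τ⁻¹ * ‖v n - v₀‖ ^ 2 + K * ‖u n - u₀‖ ^ 2 ≤ B ^ 2 := fun n => by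
      have h1 := hB ⟨n, rfl⟩
      exact (Real.sqrt_le_left ((Real.sqrt_nonneg _).trans h1)).1 h1
    refine (Bornology.IsBounded.prod (Metric.isBounded_closedBall (x := u₀) (r := √(B ^ 2 / K)))
      (Metric.isBounded_closedBall (x := v₀) (r := √(B ^ 2 / (α * τ⁻¹))))).subset ?_
    rintro _ ⟨n, rfl⟩
    have h1 := hB' n
    refine ⟨mem_closedBall_iff_norm.2 (Real.le_sqrt_of_sq_le ?_),
      mem_closedBall_iff_norm.2 (Real.le_sqrt_of_sq_le ?_)⟩
    · rw [le_div_iff₀ hKpos, mul_comm]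
      have : 0 ≤ α * τ⁻¹ * ‖v n - v₀‖ ^ 2 := by positivity
      linarith
    · rw [le_div_iff₀ (by positivity), mul_comm]
      have : 0 ≤ K * ‖u n - u₀‖ ^ 2 := by positivity
      linarith
  refine ⟨hbdd, ?_⟩
  obtain ⟨⟨u₁, v₁⟩, -, φs, hφs, hlim⟩ :=
    tendsto_subseq_of_bounded hbdd (x := fun n => (u n, v n)) fun n => ⟨n, rfl⟩
  have hu₁ : Tendsto (fun n => u (φs n)) atTop (𝓝 u₁) := (Prod.tendsto_iff _ _).1 hlim |>.1
  have hv₁ : Tendsto (fun n => v (φs n)) atTop (𝓝 v₁) := (Prod.tendsto_iff _ _).1 hlim |>.2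
  have hD0 : ∀ n, 0 ≤ α * (τ⁻¹ - α * ‖W‖ ^ 2) * ‖v n - w n 1‖ ^ 2 ∧
      0 ≤ α ^ 2 * ‖adjoint W (v n - v₀)‖ ^ 2 ∧
      0 ≤ K * (α * inner ℝ (H (ubar n - u₀)) (ubar n - u₀)) := fun n => by
    have := hmono (ubar n - u₀)
    refine ⟨by positivity, by positivity, by positivity⟩
  have hδ : Tendsto (fun n => v n - w n 1) atTop (𝓝 0) :=
    tendsto_zero_of_mul_norm_sq hκ (squeeze_zero (fun n => (hD0 n).1)
      (fun n => by have := hD0 n; linarith) hD)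
  have hadj₁ : Tendsto (fun n => adjoint W (v n - v₀)) atTop (𝓝 0) :=
    tendsto_zero_of_mul_norm_sq (pow_pos hα 2) (squeeze_zero (fun n => (hD0 n).2.1)
      (fun n => by have := hD0 n; linarith) hD)
  have hH₁ : Tendsto (fun n => H (ubar n - u₀)) atTop (𝓝 0) := by
    refine tendsto_zero_of_mul_norm_sq (c := K * (α * α)) (by positivity)
      (squeeze_zero (fun n => by positivity) (fun n => ?_) hD)
    have h1 := mul_le_mul_of_nonneg_left (hH (ubar n - u₀)) (mul_nonneg hKpos.le hα.le)
    have := hD0 n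
    linarith
  have hubar : Tendsto (fun n => ubar (φs n)) atTop (𝓝 u₁) := by
    have h1 : Tendsto (fun n => ubar n - u n) atTop (𝓝 0) :=
      tendsto_zero_iff_norm_tendsto_zero.2 hsum.tendsto_atTop_zero
    have h2 := (h1.comp hφs.tendsto_atTop).add hu₁
    simpa using h2
  -- The vanishing decrease terms fix `H u₁` and `W* v₁`, so the cluster point inherits the saddle
  -- point equation.
  have hHu : H u₁ = H u₀ := by
    have h1 := (H.continuous.tendsto _).comp (hubar.sub_const u₀)
    have h2 := tendsto_nhds_unique h1 (hH₁.comp hφs.tendsto_atTop)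
    rwa [map_sub, sub_eq_zero] at h2
  have hWv : adjoint W v₁ = adjoint W v₀ := by
    have h1 := ((adjoint W).continuous.tendsto _).comp (hv₁.sub_const v₀)
    have h2 := tendsto_nhds_unique h1 (hadj₁.comp hφs.tendsto_atTop)
    rwa [map_sub, sub_eq_zero] at h2
  have hadjeq : adjoint W v₁ = -(H u₁ - q) := by rw [hWv, hHu, hadj]
  have hsub : IsSubgradient φ (W u₁) v₁ := by
    have hδ' := hδ.comp hφs.tendsto_atTop
    -- Pass to the limit in the first dual step: `w n 1` and `v n` have the same limit along the
    -- subsequence.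
    refine isSubgradient_of_tendsto hlsc ?_ ?_ fun n => hstep (φs n) 0
    · have h1 : Tendsto (fun n => x (φs n) - α • adjoint W (w (φs n) 0)) atTop
          (𝓝 (u₁ - α • (H u₁ - q) - α • adjoint W v₁)) := by
        simp only [hx, hw0]
        exact (hubar.sub ((((H.continuous.tendsto _).comp hubar).sub_const q).const_smul α)).sub
          ((((adjoint W).continuous.tendsto _).comp hv₁).const_smul α)
      have h2 : u₁ - α • (H u₁ - q) - α • adjoint W v₁ = u₁ := by
        rw [hadjeq]
        module
      rw [h2] at h1
      have h3 := (hδ'.const_smul τ⁻¹).add ((W.continuous.tendsto _).comp h1)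
      simpa [Function.comp_def, hw0] using h3
    · have h1 := hv₁.sub hδ'
      simpa [Function.comp_def] using h1
  refine ⟨u₁, v₁, hsub, hadjeq, ?_⟩
  -- The Fejér property is now applied with the cluster point itself as reference.
  obtain ⟨⟨l', hl'⟩, -⟩ := hfejer u₁ v₁ hsub hadjeq
  have hl0 : l' = 0 := by
    have h1 : Tendsto (fun n => √(α * τ⁻¹ * ‖v (φs n) - v₁‖ ^ 2 + K * ‖u (φs n) - u₁‖ ^ 2))
        atTop (𝓝 √(α * τ⁻¹ * ‖v₁ - v₁‖ ^ 2 + K * ‖u₁ - u₁‖ ^ 2)) :=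
      ((((hv₁.sub_const v₁).norm.pow 2).const_mul _).add
        (((hu₁.sub_const u₁).norm.pow 2).const_mul _)).sqrt
    have h2 := tendsto_nhds_unique (hl'.comp hφs.tendsto_atTop) h1
    simpa using h2
  rw [hl0] at hl'
  have hsq := hl'.pow 2
  simp only [ne_eq, OfNat.ofNat_ne_zero, not_false_eq_true, zero_pow] at hsq
  refine tendsto_sub_nhds_zero_iff.1 (tendsto_zero_of_mul_norm_sq hKpos
    (squeeze_zero (fun n => by positivity) (fun n => ?_) hsq))
  rw [Real.sq_sqrt (by positivity)]
  exact le_add_of_nonneg_left (by positivity)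

end Iteration

/-- A positive symmetric operator `H` with `α ‖H‖ ≤ 1` is `α`-cocoercive. -/
theorem mul_norm_sq_le_inner_of_nonneg {E : Type*} [NormedAddCommGroup E] [InnerProductSpace ℝ E]
    {H : E →L[ℝ] E} {α : ℝ} (hα : 0 ≤ α) (hHα : α * ‖H‖ ≤ 1)
    (hsymm : ∀ x y, inner ℝ (H x) y = inner ℝ x (H y)) (hpos : ∀ z, 0 ≤ inner ℝ (H z) z) (z : E) :
    α * ‖H z‖ ^ 2 ≤ inner ℝ (H z) z := by
  -- Testing positivity at the gradient step `z - α H z` gives the bound without a square root of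
  -- `H`.
  have h1 := hpos (z - α • H z)
  have h2 : inner ℝ (H (H z)) z = ‖H z‖ ^ 2 := by rw [hsymm, real_inner_self_eq_norm_sq]
  have h3 : inner ℝ (H (H z)) (H z) ≤ ‖H‖ * ‖H z‖ ^ 2 := by
    refine (real_inner_le_norm _ _).trans ?_
    rw [pow_two, ← mul_assoc]
    exact mul_le_mul_of_nonneg_right (H.le_opNorm _) (norm_nonneg _)
  rw [map_sub, map_smul, inner_sub_left, inner_sub_right, inner_sub_right, real_inner_smul_left,
    real_inner_smul_left, real_inner_smul_right, real_inner_smul_right, h2,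
    real_inner_self_eq_norm_sq] at h1
  have h4 := mul_le_mul_of_nonneg_left h3 (mul_nonneg hα hα)
  have h5 := mul_le_mul_of_nonneg_left hHα (mul_nonneg hα (sq_nonneg ‖H z‖))
  nlinarith

/-! ### Matrices as operators on Euclidean space -/

section Matrices

variable {l m n : ℕ}

/-- The action `app M` as a continuous linear map. -/
noncomputable def appL (M : Matrix (Fin m) (Fin n) ℝ) : Vec n →L[ℝ] Vec m :=
  LinearMap.toContinuousLinearMap (Matrix.toEuclideanLin M)

theorem appL_apply (M : Matrix (Fin m) (Fin n) ℝ) (u : Vec n) : appL M u = app M u := rfl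

theorem norm_appL (M : Matrix (Fin m) (Fin n) ℝ) : ‖appL M‖ = ‖M‖ :=
  (Matrix.l2_opNorm_def M).symm

theorem app_app (M : Matrix (Fin l) (Fin m) ℝ) (N : Matrix (Fin m) (Fin n) ℝ) (u : Vec n) :
    app M (app N u) = app (M * N) u := by
  simp [app, Matrix.mulVec_mulVec]

theorem inner_app_left (M : Matrix (Fin m) (Fin n) ℝ) (u : Vec n) (v : Vec m) :
    inner ℝ (app M u) v = inner ℝ u (app M.transpose v) := by
  simp only [app, EuclideanSpace.inner_eq_star_dotProduct, star_trivial]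
  rw [Matrix.dotProduct_mulVec, Matrix.mulVec_transpose]

theorem adjoint_appL (M : Matrix (Fin m) (Fin n) ℝ) : adjoint (appL M) = appL M.transpose := by
  refine ((eq_adjoint_iff _ _).2 fun v u => ?_).symm
  rw [appL_apply, appL_apply, inner_app_left, Matrix.transpose_transpose]

theorem inner_app_nonneg {M : Matrix (Fin n) (Fin n) ℝ} (hM : M.PosDef) (u : Vec n) :
    0 ≤ inner ℝ u (app M u) := by
  have h1 := hM.posSemidef.dotProduct_mulVec_nonneg u.ofLp
  simp only [app, EuclideanSpace.inner_eq_star_dotProduct, star_trivial] at h1 ⊢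
  rwa [dotProduct_comm]

theorem normM_sq {M : Matrix (Fin n) (Fin n) ℝ} (hM : M.PosDef) (u : Vec n) :
    normM M u ^ 2 = inner ℝ u (app M u) :=
  Real.sq_sqrt (inner_app_nonneg hM u)

theorem transpose_eq_of_posDef {M : Matrix (Fin n) (Fin n) ℝ} (hM : M.PosDef) :
    M.transpose = M := by
  simpa [Matrix.conjTranspose_eq_transpose_of_trivial] using hM.isHermitian.eq

theorem gradient_fidelity (A : Matrix (Fin m) (Fin n) ℝ) (b : Vec m) (u : Vec n) :
    gradient (fidelity A b) u = app A.transpose (app A u - b) := by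
  refine HasGradientAt.gradient ?_
  have h1 : HasFDerivAt (fun u => appL A u - b) (appL A) u := (appL A).hasFDerivAt.sub_const b
  have h2 : HasFDerivAt (fidelity A b) _ u := h1.norm_sq.const_mul (1 / 2)
  rw [hasGradientAt_iff_hasFDerivAt]
  refine h2.congr_fderiv (ContinuousLinearMap.ext fun z => ?_)
  simp only [InnerProductSpace.toDual_apply_apply, smul_apply, comp_apply, innerSL_apply_apply,
    smul_eq_mul, nsmul_eq_mul, Nat.cast_ofNat]
  rw [appL_apply, appL_apply, inner_app_left A.transpose, Matrix.transpose_transpose,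
    real_inner_comm]
  ring

end Matrices

/-! ### KKT conditions for the preconditioned problem -/

section Problem

variable {s d m : ℕ} {A : Matrix (Fin s) (Fin d) ℝ} {b : Vec s} {S : Matrix (Fin s) (Fin s) ℝ}
  {W : Matrix (Fin m) (Fin d) ℝ} {h : Vec m → EReal}

/-- The exact second-order expansion serves both directions of the KKT conditions: the linear term
gives the gradient, and the quadratic term is nonnegative and homogeneous of degree two. -/
theorem half_normM_sq_add (hS : S.PosDef) (u z : Vec d) :
    1 / 2 * normM S⁻¹ (app A (u + z) - b) ^ 2 = 1 / 2 * normM S⁻¹ (app A u - b) ^ 2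
      + inner ℝ (app (A.transpose * S⁻¹) (app A u - b)) z
      + 1 / 2 * inner ℝ (app A z) (app S⁻¹ (app A z)) := by
  have h1 : app A (u + z) - b = (app A u - b) + app A z := by
    simp only [← appL_apply, map_add]; abel
  have h2 : inner ℝ (app (A.transpose * S⁻¹) (app A u - b)) z
      = inner ℝ (app S⁻¹ (app A u - b)) (app A z) := by
    rw [← app_app, inner_app_left, Matrix.transpose_transpose]
  have h3 : inner ℝ (app A u - b) (app S⁻¹ (app A z))
      = inner ℝ (app S⁻¹ (app A u - b)) (app A z) := by
    rw [inner_app_left, transpose_eq_of_posDef hS.inv]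
  have h4 : app S⁻¹ ((app A u - b) + app A z) = app S⁻¹ (app A u - b) + app S⁻¹ (app A z) :=
    (appL S⁻¹).map_add _ _
  rw [normM_sq hS.inv, normM_sq hS.inv, h1, h2, h4, inner_add_left, inner_add_right,
    inner_add_right, h3, real_inner_comm (app A z) (app S⁻¹ (app A u - b))]
  ring

/-- The Karush–Kuhn–Tucker conditions are sufficient. -/
theorem isSolution_of_isSubgradient (hS : S.PosDef) (hproper : IsProper h) {u : Vec d} {v : Vec m}
    (hv : IsSubgradient h (app W u) v)
    (hadj : app W.transpose v = -app (A.transpose * S⁻¹) (app A u - b)) :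
    IsSolution A b S W h u := by
  intro y _
  show objective A b S W h u ≤ objective A b S W h y
  unfold objective
  by_cases hy : h (app W y) = ⊤
  · rw [hy, EReal.coe_add_top]
    exact le_top
  have ht : h (app W y) = ((h (app W y)).toReal : EReal) :=
    (EReal.coe_toReal hy (hproper.1 _)).symm
  have h1 := hv _ _ ht.le
  have h2 : inner ℝ v (app W y - app W u)
      = -inner ℝ (app (A.transpose * S⁻¹) (app A u - b)) (y - u) := by
    rw [← inner_neg_left, ← hadj, inner_app_left, Matrix.transpose_transpose]
    simp only [← appL_apply, map_sub]
  have h3 := half_normM_sq_add (A := A) (b := b) hS u (y - u)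
  have h4 := inner_app_nonneg hS.inv (app A (y - u))
  rw [add_sub_cancel] at h3
  refine (add_le_add_right h1 _).trans ?_
  rw [ht, ← EReal.coe_add, ← EReal.coe_add, EReal.coe_le_coe_iff, h2, h3]
  simp only [EReal.toReal_coe]
  linarith

/-- The Karush–Kuhn–Tucker conditions are necessary under the qualification condition. -/
theorem IsSolution.exists_isSubgradient (hS : S.PosDef) (hproper : IsProper h)
    (hconvex : IsConvex h) (hW : ∃ x : Vec d, app W x ∈ intrinsicInterior ℝ (dom h)) {u : Vec d}
    (hu : IsSolution A b S W h u) :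
    ∃ v, IsSubgradient h (app W u) v ∧
      app W.transpose v = -app (A.transpose * S⁻¹) (app A u - b) := by
  obtain ⟨x, hx⟩ := hW
  have hfin : h (app W u) ≠ ⊤ := by
    intro htop
    have h1 : objective A b S W h u ≤ objective A b S W h x := hu (Set.mem_univ x)
    unfold objective at h1
    rw [htop, EReal.coe_add_top] at h1
    have h2 : app W x ∈ dom h := intrinsicInterior_subset hx
    exact absurd (h1.trans_lt (EReal.add_lt_top (EReal.coe_ne_top _) (ne_of_lt h2))) (lt_irrefl _)
  have hr : h (appL W u) = ((h (app W u)).toReal : EReal) :=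
    (EReal.coe_toReal hfin (hproper.1 _)).symm
  have hopt := le_add_inner_of_isMinOn (W := appL W) hconvex
    (half_normM_sq_add (A := A) (b := b) hS u)
    (fun l z => by
      simp only [← appL_apply, map_smul, real_inner_smul_left, real_inner_smul_right]
      ring) hr hu
  obtain ⟨v, hv, hadj⟩ := exists_isSubgradient_adjoint_eq_neg (W := appL W) hconvex hx hr hopt
  rw [adjoint_appL] at hadj
  exact ⟨v, hv, hadj⟩

end Problem

end PNPD

/-- Matrix norms are operator norms with respect to the Euclidean norms. The step length bounds
`α ≤ ‖P⁻¹AᵀA‖⁻¹` and `β < ‖W‖⁻²` are written without division, so that a zero norm imposes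
no upper bound. -/
theorem theorem5 {s d m : ℕ}
    (A : Matrix (Fin s) (Fin d) ℝ) (b : PNPD.Vec s)
    (W : Matrix (Fin m) (Fin d) ℝ) (h : PNPD.Vec m → EReal)
    (S : Matrix (Fin s) (Fin s) ℝ) (P : Matrix (Fin d) (Fin d) ℝ)
    (hproper : PNPD.IsProper h) (hconvex : PNPD.IsConvex h) (hlsc : LowerSemicontinuous h)
    (hW : ∃ x : PNPD.Vec d, PNPD.app W x ∈ intrinsicInterior ℝ (PNPD.dom h))
    (hsol : ∃ x : PNPD.Vec d, PNPD.IsSolution A b S W h x)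
    (hS : S.PosDef) (hP : P.PosDef)
    (hPS : P⁻¹ * A.transpose = A.transpose * S⁻¹)
    (α β : ℝ) (hα : 0 < α) (hα' : α * ‖P⁻¹ * A.transpose * A‖ ≤ 1)
    (hβ : 0 < β) (hβ' : β * ‖W‖ ^ 2 < 1)
    (kmax : ℕ) (hk : 1 ≤ kmax) (γ : ℕ → ℝ) (hγ : ∀ n, 0 ≤ γ n) (u₀ : PNPD.Vec d)
    (hsum : Summable fun n =>
      γ n * ‖(PNPD.iterate A b P W h α β kmax γ u₀ n).u -
        (PNPD.iterate A b P W h α β kmax γ u₀ n).uPrev‖) :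
    Bornology.IsBounded (Set.range fun n =>
      ((PNPD.iterate A b P W h α β kmax γ u₀ n).u,
        (PNPD.iterate A b P W h α β kmax γ u₀ n).v)) ∧
    ∃ uhat : PNPD.Vec d, PNPD.IsSolution A b S W h uhat ∧
      Filter.Tendsto (fun n => (PNPD.iterate A b P W h α β kmax γ u₀ n).u)
        Filter.atTop (nhds uhat) := by
  obtain ⟨x₀, hx₀⟩ := hsol
  obtain ⟨v₀, hv₀, hadj₀⟩ := hx₀.exists_isSubgradient hS hproper hconvex hW
  let σ := PNPD.iterate A b P W h α β kmax γ u₀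
  let ubar : ℕ → PNPD.Vec d := fun n => (σ n).u + γ n • ((σ n).u - (σ n).uPrev)
  let x : ℕ → PNPD.Vec d := fun n => PNPD.halfStep A b P α (γ n) (σ n).uPrev (σ n).u
  let H := PNPD.appL (A.transpose * S⁻¹ * A)
  let q := PNPD.app (A.transpose * S⁻¹) b
  have hHq : ∀ u, H u - q = PNPD.app (A.transpose * S⁻¹) (PNPD.app A u - b) := fun u => by
    have h1 : H u = PNPD.app (A.transpose * S⁻¹) (PNPD.app A u) := (PNPD.app_app _ _ _).symm
    rw [h1]
    simp only [q, ← PNPD.appL_apply, map_sub]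
  have hinner : ∀ y z, inner ℝ (H y) z = inner ℝ (PNPD.app S⁻¹ (PNPD.app A y)) (PNPD.app A z) :=
    fun y z => by
      have h1 : H y = PNPD.app A.transpose (PNPD.app S⁻¹ (PNPD.app A y)) := by
        rw [PNPD.app_app, PNPD.app_app]
        rfl
      rw [h1, PNPD.inner_app_left, Matrix.transpose_transpose]
  have hH : ∀ z, α * ‖H z‖ ^ 2 ≤ inner ℝ (H z) z := by
    refine PNPD.mul_norm_sq_le_inner_of_nonneg hα.le ?_ (fun y z => ?_) fun z => ?_
    · rwa [PNPD.norm_appL, ← hPS]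
    · rw [real_inner_comm (H z) y, hinner, hinner, PNPD.inner_app_left,
        PNPD.transpose_eq_of_posDef hS.inv, real_inner_comm]
    · rw [hinner, real_inner_comm]
      exact PNPD.inner_app_nonneg hS.inv _
  have hτ : 0 < β * α⁻¹ := by positivity
  obtain ⟨hbdd, uhat, vhat, hvhat, hadj, hlim⟩ := PNPD.nested_primal_dual_converges
    (φ := h) (W := PNPD.appL W) (H := H) (q := q) (α := α) (τ := β * α⁻¹) (K := kmax)
    (u := fun n => (σ n).u) (v := fun n => (σ n).v) (ubar := ubar) (x := x)
    (w := fun n => PNPD.innerDual W h α β (x n) (σ n).v)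
    hproper.1 hproper.2 hlsc hα
    (by
      -- With `τ = β α⁻¹`, the requirement `α ‖W‖² < τ⁻¹` is `β ‖W‖² < 1` multiplied by `α / β`.
      rw [PNPD.norm_appL, mul_inv, inv_inv, ← div_eq_inv_mul, lt_div_iff₀ hβ]
      nlinarith) hH hk
    (fun n => by
      show ubar n - α • PNPD.app P⁻¹ (gradient (PNPD.fidelity A b) (ubar n)) = _
      rw [PNPD.gradient_fidelity, PNPD.app_app, hPS, hHq])
    (fun n => rfl) (fun n => rfl)
    (fun n => by rw [PNPD.adjoint_appL]; rfl)
    (fun n k => by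
      rw [PNPD.adjoint_appL]
      have h1 := PNPD.isSubgradient_prox_conjugate hproper hconvex hlsc hτ
        (PNPD.innerDual W h α β (x n) (σ n).v k + (β * α⁻¹) •
          PNPD.app W (PNPD.innerPrimal W α (x n) (PNPD.innerDual W h α β (x n) (σ n).v k)))
      -- Regroup the Moreau point as `τ⁻¹ (w_k - w_{k+1})` plus `W` applied to the inner primal
      -- point.
      rw [add_sub_right_comm, smul_add, inv_smul_smul₀ hτ.ne'] at h1
      exact h1)
    (by
      refine hsum.congr fun n => ?_
      simp only [ubar, add_sub_cancel_left, norm_smul, Real.norm_of_nonneg (hγ n)]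
      rfl)
    ⟨x₀, v₀, hv₀, by rw [PNPD.adjoint_appL, hHq]; exact hadj₀⟩
  rw [PNPD.adjoint_appL, hHq] at hadj
  exact ⟨hbdd, uhat, PNPD.isSolution_of_isSubgradient hS hproper hvhat hadj, hlim⟩
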